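/- Let $\mathbb K\in\{\mathbb R,\mathbb C\}$ and let $\mathfrak g$ be a finite-dimensional completely solvable Lie algebra over $\mathbb K$ with a Jordan–Hölder sequence, that is, a sequence of ideals $\{0\}=\mathfrak g_0\subsetneq\mathfrak g_1\subsetneq\cdots\subsetneq\mathfrak g_m=\mathfrak g$ of $\mathfrak g$ with $\dim\mathfrak g_j=j$ for $j=0,\dots,m$. For a Lie algebra $\mathfrak h$ and $\eta\in\mathfrak h^*$ write $\mathfrak h(\eta)=\{x\in\mathfrak h : \eta([x,y])=0 \text{ for all } y\in\mathfrak h\}$. Let $\mathrm{Gr}(\mathfrak g)$ be the set of all linear subspaces of $\mathfrak g$ with its usual topology, i.e. the disjoint union of the Grassmann manifolds $\mathrm{Gr}_k(\mathfrak g)$ of $k$-dimensional subspaces, and let $\mathrm{Gr}_{\mathrm{alg}}(\mathfrak g)\subseteq\mathrm{Gr}(\mathfrak g)$ be the topological subspace of all Lie subalgebras. For every $\xi\in\mathfrak g^*$ set $$\mathfrak p_{\mathrm{alg}}(\xi)=\mathfrak g_1(\xi|_{\mathfrak g_1})+\cdots+\mathfrak g_{m-1}(\xi|_{\mathfrak g_{m-1}})+\mathfrak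 g_m(\xi).$$ Then $\mathfrak p_{\mathrm{alg}}(\xi)$ is a Lie subalgebra of $\mathfrak g$ for every $\xi\in\mathfrak g^*$, so that there is a map (the Vergne mapping) $\mathfrak p_{\mathrm{alg}}\colon\mathfrak g^*\to\mathrm{Gr}_{\mathrm{alg}}(\mathfrak g)$. Moreover, for every tuple of integers $\mathbf k=(k_1,\dots,k_m)$ with $0\le k_j\le j$ put $$\Xi_{\mathbf k}=\{\xi\in\mathfrak g^* : \dim\mathfrak g_j(\xi|_{\mathfrak g_j})=k_j \text{ for } j=1,\dots,m\}.$$ If $\Xi\subseteq\mathfrak g^*$ is a subset such that $\Xi\cap\Xi_{\mathbf k}$ is relatively closed in $\Xi$ for every such $\mathbf k$, then the restriction $\mathfrak p_{\mathrm{alg}}|_\Xi\colon\Xi\to\mathrm{Gr}_{\mathrm{alg}}(\mathfrak g)$ is continuous. -/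

import Mathlib

open Module

section Grassmannian

variable (𝕜 V : Type*) [RCLike 𝕜] [AddCommGroup V] [Module 𝕜 V]

/-- The `k`-frames of `V`: linearly independent `k`-tuples of vectors of `V`. -/
abbrev Frame (k : ℕ) : Type _ := {v : Fin k → V // LinearIndependent 𝕜 v}

/-- The topology of the set of `k`-frames of `V`, as a subspace of `V ^ k`, where `V` has its
canonical topology over `𝕜` (for finite-dimensional `V`, the only Hausdorff vector space
topology). -/
abbrev frameTopology (k : ℕ) : TopologicalSpace (Frame 𝕜 V k) :=
  letI : TopologicalSpace V := moduleTopology 𝕜 V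
  inferInstance

/-- The Grassmannian `Gr(V)` of all linear subspaces of a finite-dimensional vector space `V`, as
a topological space: it is the disjoint union over `k` of the spaces `Gr_k(V)` of
`k`-dimensional subspaces, each with the quotient topology of the space of `k`-frames under the
map that sends a frame to its span. -/
instance grassmannTopology [FiniteDimensional 𝕜 V] : TopologicalSpace (Submodule 𝕜 V) :=
  letI := frameTopology 𝕜 V
  TopologicalSpace.coinduced
    (fun v : (Σ k : ℕ, Frame 𝕜 V k) => Submodule.span 𝕜 (Set.range v.2.1)) inferInstance

/-- The canonical topology of the linear dual of a finite-dimensional vector space. -/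
instance dualTopology [FiniteDimensional 𝕜 V] : TopologicalSpace (Dual 𝕜 V) :=
  moduleTopology 𝕜 (Dual 𝕜 V)

end Grassmannian

section Lie

variable {𝕜 𝔤 : Type*} [RCLike 𝕜] [LieRing 𝔤] [LieAlgebra 𝕜 𝔤]

/-- The set `Gr_alg(𝔤)` of all Lie subalgebras of `𝔤`, topologized as a subspace of `Gr(𝔤)`. -/
instance lieSubalgebraTopology [FiniteDimensional 𝕜 𝔤] :
    TopologicalSpace (LieSubalgebra 𝕜 𝔤) :=
  TopologicalSpace.induced LieSubalgebra.toSubmodule inferInstance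

/-- The isotropy subspace `𝔤(ξ) = {x ∈ 𝔤 | ⟨ξ, [x, y]⟩ = 0 for all y ∈ 𝔤}`, that is, the
null-space of the skew-symmetric form `B_ξ (x, y) = ⟨ξ, [x, y]⟩`. -/
def isotropy (ξ : Dual 𝕜 𝔤) : Submodule 𝕜 𝔤 where
  carrier := {x | ∀ y, ξ ⁅x, y⁆ = 0}
  zero_mem' := by simp
  add_mem' := by
    intro a b ha hb y
    rw [add_lie, map_add, ha y, hb y, add_zero]
  smul_mem' := by
    intro c a ha y
    rw [smul_lie, map_smul, ha y, smul_zero]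

/-- For an ideal `I` of `𝔤`, the isotropy subspace `I(ξ|_I) ⊆ I` of the restriction of `ξ` to the
Lie algebra `I`. -/
def idealIsotropy (I : LieIdeal 𝕜 𝔤) (ξ : Dual 𝕜 𝔤) : Submodule 𝕜 I :=
  isotropy (ξ ∘ₗ I.toSubmodule.subtype : Dual 𝕜 I)

variable (𝕜 𝔤) in
/-- A Jordan–Hölder sequence `0 = 𝔤_0 ⊊ 𝔤_1 ⊊ ⋯ ⊊ 𝔤_m = 𝔤` of ideals of `𝔤` with
`dim 𝔤_j = j`. A finite-dimensional Lie algebra is called completely solvable if it has one. -/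
structure JordanHolderSequence (m : ℕ) where
  /-- The ideals of the sequence. -/
  ideal : Fin (m + 1) → LieIdeal 𝕜 𝔤
  strictMono : StrictMono ideal
  ideal_zero : ideal 0 = ⊥
  ideal_last : ideal (Fin.last m) = ⊤
  finrank_ideal : ∀ j, finrank 𝕜 (ideal j) = (j : ℕ)

/-- The Vergne mapping with values in linear subspaces,
`ξ ↦ 𝔤_1(ξ|_{𝔤_1}) + ⋯ + 𝔤_m(ξ|_{𝔤_m})`, each summand being regarded as a subspace of `𝔤`. -/
def vergne {m : ℕ} (F : JordanHolderSequence 𝕜 𝔤 m) (ξ : Dual 𝕜 𝔤) : Submodule 𝕜 𝔤 :=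
  ⨆ j : Fin m,
    (idealIsotropy (F.ideal j.succ) ξ).map (F.ideal j.succ).toSubmodule.subtype

/-- The multi-indices `(k_1, …, k_m)` with `0 ≤ k_j ≤ j`; the entry `k_j` is `k (j - 1)`. -/
def multiIndices (m : ℕ) : Set (Fin m → ℕ) :=
  {k | ∀ j : Fin m, k j ≤ (j : ℕ) + 1}

/-- The set `Ξ_k` of all `ξ ∈ 𝔤*` with `dim 𝔤_j(ξ|_{𝔤_j}) = k_j` for `j = 1, …, m`. -/
def isotropyStratum {m : ℕ} (F : JordanHolderSequence 𝕜 𝔤 m) (k : Fin m → ℕ) :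
    Set (Dual 𝕜 𝔤) :=
  {ξ | ∀ j : Fin m, finrank 𝕜 (idealIsotropy (F.ideal j.succ) ξ) = k j}

end Lie

/-! ### The Vergne space as a Lagrangian-type subalgebra -/

section Algebra

variable {𝕜 𝔤 : Type*} [RCLike 𝕜] [LieRing 𝔤] [LieAlgebra 𝕜 𝔤]

/-! With respect to the form `ξ ⁅x, y⁆`, the Vergne space equals its own orthogonal, so twice its
dimension is `m + dim 𝔤(ξ)` (`two_mul_finrank_vergne`) and is constant on each stratum. There are
finitely many strata, so closed strata in `Ξ` are also open, and near `ξ` all isotropy dimensions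
are constant. Take a basis of the Vergne space at `ξ` whose members each lie in one isotropy
subspace. Since that subspace is the kernel of a map depending continuously on the functional,
constant rank extends each basis vector continuously (`exists_continuousAt_section_ker`). The
extensions stay independent and inside the Vergne space; by equality of dimensions they span it,
which is continuity in the Grassmannian. -/

/-- The isotropy subspace `I(ξ|_I)` regarded as a subspace of `𝔤`. -/
def isotropyIn (I : LieIdeal 𝕜 𝔤) (ξ : Dual 𝕜 𝔤) : Submodule 𝕜 𝔤 :=
  (idealIsotropy I ξ).map I.toSubmodule.subtype

theorem mem_isotropyIn {I : LieIdeal 𝕜 𝔤} {ξ : Dual 𝕜 𝔤} {x : 𝔤} :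
    x ∈ isotropyIn I ξ ↔ x ∈ I ∧ ∀ y ∈ I, ξ ⁅x, y⁆ = 0 := by
  constructor
  · rintro ⟨z, hz, rfl⟩
    exact ⟨z.2, fun y hy => hz ⟨y, hy⟩⟩
  · rintro ⟨hx, h⟩
    exact ⟨⟨x, hx⟩, fun y => h y y.2, rfl⟩

theorem vergne_eq_iSup_isotropyIn {m : ℕ} (F : JordanHolderSequence 𝕜 𝔤 m) (ξ : Dual 𝕜 𝔤) :
    vergne F ξ = ⨆ j : Fin m, isotropyIn (F.ideal j.succ) ξ := rfl

theorem isotropyIn_le_vergne {m : ℕ} (F : JordanHolderSequence 𝕜 𝔤 m) (ξ : Dual 𝕜 𝔤) (j : Fin m) :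
    isotropyIn (F.ideal j.succ) ξ ≤ vergne F ξ :=
  le_iSup (fun j : Fin m => isotropyIn (F.ideal j.succ) ξ) j

theorem finrank_isotropyIn (I : LieIdeal 𝕜 𝔤) (ξ : Dual 𝕜 𝔤) :
    finrank 𝕜 (isotropyIn I ξ) = finrank 𝕜 (idealIsotropy I ξ) :=
  (Submodule.equivMapOfInjective _ I.toSubmodule.injective_subtype _).finrank_eq.symm

/-- Jacobi: `⁅⁅x, y⁆, z⁆ = ⁅x, ⁅y, z⁆⁆ - ⁅y, ⁅x, z⁆⁆`, and both inner brackets stay in `I`. -/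
theorem lie_mem_isotropyIn {I J : LieIdeal 𝕜 𝔤} (hIJ : I ≤ J) {ξ : Dual 𝕜 𝔤} {x y : 𝔤}
    (hx : x ∈ isotropyIn I ξ) (hy : y ∈ isotropyIn J ξ) : ⁅x, y⁆ ∈ isotropyIn I ξ := by
  rw [mem_isotropyIn] at *
  refine ⟨lie_mem_left 𝕜 𝔤 I x y hx.1, fun z hz => ?_⟩
  rw [lie_lie, map_sub, hx.2 _ (lie_mem_right 𝕜 𝔤 I y z hz),
    hy.2 _ (hIJ (lie_mem_right 𝕜 𝔤 I x z hz)), sub_zero]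

variable {m : ℕ} (F : JordanHolderSequence 𝕜 𝔤 m) (ξ : Dual 𝕜 𝔤)

theorem lie_mem_vergne {x y : 𝔤} (hx : x ∈ vergne F ξ) (hy : y ∈ vergne F ξ) :
    ⁅x, y⁆ ∈ vergne F ξ := by
  rw [vergne_eq_iSup_isotropyIn] at hx hy
  induction hx using Submodule.iSup_induction' with
  | zero => simp
  | add a b _ _ ha hb => rw [add_lie]; exact add_mem ha hb
  | mem i x hx =>
    induction hy using Submodule.iSup_induction' with
    | zero => simp
    | add a b _ _ ha hb => rw [lie_add]; exact add_mem ha hb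
    | mem j y hy =>
      rcases le_total i j with h | h
      · exact isotropyIn_le_vergne F ξ i (lie_mem_isotropyIn
          (F.strictMono.monotone (Fin.succ_le_succ_iff.2 h)) hx hy)
      · rw [← lie_skew]
        exact neg_mem (isotropyIn_le_vergne F ξ j (lie_mem_isotropyIn
          (F.strictMono.monotone (Fin.succ_le_succ_iff.2 h)) hy hx))

theorem vergne_isotropic {x y : 𝔤} (hx : x ∈ vergne F ξ) (hy : y ∈ vergne F ξ) :
    ξ ⁅x, y⁆ = 0 := by
  rw [vergne_eq_iSup_isotropyIn] at hx hy
  induction hx using Submodule.iSup_induction' with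
  | zero => simp
  | add a b _ _ ha hb => rw [add_lie, map_add, ha, hb, add_zero]
  | mem i x hx =>
    induction hy using Submodule.iSup_induction' with
    | zero => simp
    | add a b _ _ ha hb => rw [lie_add, map_add, ha, hb, add_zero]
    | mem j y hy =>
      rw [mem_isotropyIn] at hx hy
      rcases le_total i j with h | h
      · rw [← lie_skew, map_neg, hy.2 _ (F.strictMono.monotone (Fin.succ_le_succ_iff.2 h) hx.1),
          neg_zero]
      · exact hx.2 _ (F.strictMono.monotone (Fin.succ_le_succ_iff.2 h) hy.1)

variable [FiniteDimensional 𝕜 𝔤]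

/-- A functional `⟨ξ, [·, x]⟩` on an ideal that kills the isotropy subspace is represented by an
element of the ideal. -/
theorem exists_mem_ideal_lie_eq (I : LieIdeal 𝕜 𝔤) {x : 𝔤}
    (hx : ∀ y ∈ isotropyIn I ξ, ξ ⁅y, x⁆ = 0) : ∃ w ∈ I, ∀ y ∈ I, ξ ⁅y, x⁆ = ξ ⁅y, w⁆ := by
  let B : I →ₗ[𝕜] Dual 𝕜 I :=
    LinearMap.mk₂ 𝕜 (fun a b : I => ξ ⁅(a : 𝔤), (b : 𝔤)⁆) (by simp) (by simp) (by simp) (by simp)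
  let φ : Dual 𝕜 I :=
    { toFun := fun a => ξ ⁅(a : 𝔤), x⁆
      map_add' := by simp
      map_smul' := by simp }
  have hφ : φ ∈ (LinearMap.ker B).dualAnnihilator := by
    rw [Submodule.mem_dualAnnihilator]
    intro a ha
    exact hx a (mem_isotropyIn.2 ⟨a.2, fun y hy => congr($ha ⟨y, hy⟩)⟩)
  -- In finite dimension, the functionals killing the radical are exactly those represented by the
  -- form.
  rw [LinearMap.dualAnnihilator_ker_eq_range_flip] at hφ
  obtain ⟨w, hw⟩ := hφ
  exact ⟨w, w.2, fun y hy => congr($hw.symm ⟨y, hy⟩)⟩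

theorem mem_sup_span_of_notMem (j : Fin m) {x y : 𝔤} (hx : x ∈ F.ideal j.succ)
    (hx' : x ∉ F.ideal j.castSucc) (hy : y ∈ F.ideal j.succ) :
    ∃ c : 𝕜, ∃ z ∈ F.ideal j.castSucc, y = z + c • x := by
  have hle : (F.ideal j.castSucc).toSubmodule ⊔ 𝕜 ∙ x ≤ (F.ideal j.succ).toSubmodule :=
    sup_le (F.strictMono.monotone j.castSucc_lt_succ.le)
      ((Submodule.span_singleton_le_iff_mem _ _).2 hx)
  have hlt : (F.ideal j.castSucc).toSubmodule < (F.ideal j.castSucc).toSubmodule ⊔ 𝕜 ∙ x :=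
    lt_of_le_of_ne le_sup_left fun h => hx' (h.symm ▸ Submodule.mem_sup_right
      (Submodule.mem_span_singleton_self x) : x ∈ (F.ideal j.castSucc).toSubmodule)
  have h1 := Submodule.finrank_lt_finrank_of_lt hlt
  have h2 : finrank 𝕜 (F.ideal j.castSucc).toSubmodule = j := F.finrank_ideal j.castSucc
  have h3 : finrank 𝕜 (F.ideal j.succ).toSubmodule = j + 1 := F.finrank_ideal j.succ
  have heq := Submodule.eq_of_le_of_finrank_le hle (by omega)
  have hy' : y ∈ (F.ideal j.castSucc).toSubmodule ⊔ 𝕜 ∙ x := heq ▸ hy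
  obtain ⟨z, hz, u, hu, rfl⟩ := Submodule.mem_sup.1 hy'
  obtain ⟨c, rfl⟩ := Submodule.mem_span_singleton.1 hu
  exact ⟨c, z, hz, rfl⟩

/-- At the top index this says that the orthogonal of the Vergne space lies inside it. Inductively
`x = (x - w) + w`, where `w` in the previous ideal induces the same functional there as `x`. Then `x
- w` is orthogonal to that ideal and to itself, hence to the next ideal, which is one dimension
larger. -/
theorem mem_vergne_of_orthogonal (j : Fin (m + 1)) : ∀ x ∈ F.ideal j,
    (∀ i : Fin m, i.succ ≤ j → ∀ y ∈ isotropyIn (F.ideal i.succ) ξ, ξ ⁅y, x⁆ = 0) →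
    x ∈ vergne F ξ := by
  induction j using Fin.induction with
  | zero =>
    intro x hx _
    rw [F.ideal_zero, LieSubmodule.mem_bot] at hx
    simp [hx]
  | succ j ih =>
    intro x hx h
    have hj := j.castSucc_lt_succ
    by_cases hx' : x ∈ F.ideal j.castSucc
    · exact ih x hx' fun i hi => h i (hi.trans hj.le)
    obtain ⟨w, hw, hwx⟩ : ∃ w ∈ F.ideal j.castSucc, ∀ y ∈ F.ideal j.castSucc,
        ξ ⁅y, x⁆ = ξ ⁅y, w⁆ := by
      refine exists_mem_ideal_lie_eq ξ _ fun y hy => ?_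
      -- The hypothesis only covers successor indices; the zero ideal is separate.
      rcases Fin.eq_zero_or_eq_succ j.castSucc with h0 | ⟨i, hi⟩
      · rw [h0, F.ideal_zero, mem_isotropyIn, LieSubmodule.mem_bot] at hy
        simp [hy.1]
      · exact h i (hi ▸ hj.le) y (hi ▸ hy)
    have hwj : w ∈ F.ideal j.succ := F.strictMono.monotone hj.le hw
    have hxw : x - w ∈ isotropyIn (F.ideal j.succ) ξ := by
      refine mem_isotropyIn.2 ⟨sub_mem hx hwj, fun y hy => ?_⟩
      obtain ⟨c, z, hz, rfl⟩ := mem_sup_span_of_notMem F j (sub_mem hx hwj)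
        (fun hmem => hx' (by simpa using add_mem hmem hw)) hy
      rw [← lie_skew]
      simp [hwx z hz]
    have hwv : w ∈ vergne F ξ := by
      refine ih w hw fun i hi y hy => ?_
      have h1 := h i (hi.trans hj.le) y hy
      have h2 := (mem_isotropyIn.1 hxw).2 y
        (F.strictMono.monotone (hi.trans hj.le) (mem_isotropyIn.1 hy).1)
      rw [← lie_skew, map_neg, neg_eq_zero, lie_sub, map_sub, h1, zero_sub, neg_eq_zero] at h2
      exact h2
    simpa using add_mem (isotropyIn_le_vergne F ξ j hxw) hwv

theorem two_mul_finrank_vergne :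
    2 * finrank 𝕜 (vergne F ξ) = m + finrank 𝕜 (isotropyIn (F.ideal (Fin.last m)) ξ) := by
  let B : LinearMap.BilinForm 𝕜 𝔤 :=
    LinearMap.mk₂ 𝕜 (fun a b : 𝔤 => ξ ⁅a, b⁆) (by simp) (by simp) (by simp) (by simp)
  have hker : B.ker = isotropyIn (F.ideal (Fin.last m)) ξ := by
    ext x
    rw [mem_isotropyIn, F.ideal_last]
    exact ⟨fun h => ⟨trivial, fun y _ => congr($h y)⟩,
      fun h => LinearMap.ext fun y => h.2 y trivial⟩
  have horth : B.orthogonal (vergne F ξ) = vergne F ξ := by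
    ext x
    rw [LinearMap.BilinForm.mem_orthogonal_iff]
    refine ⟨fun h => mem_vergne_of_orthogonal F ξ (Fin.last m) x ?_ fun i _ y hy =>
      h y (isotropyIn_le_vergne F ξ i hy), fun hx y hy => vergne_isotropic F ξ hy hx⟩
    rw [F.ideal_last]
    trivial
  have hle : B.ker ≤ vergne F ξ := by
    intro x hx
    refine horth ▸ (LinearMap.BilinForm.mem_orthogonal_iff.2 fun y _ => ?_)
    change ξ ⁅y, x⁆ = 0
    rw [← lie_skew, map_neg, neg_eq_zero]
    exact congr($hx y)
  have hm : finrank 𝕜 𝔤 = m := by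
    have h : finrank 𝕜 (F.ideal (Fin.last m)).toSubmodule = m := F.finrank_ideal (Fin.last m)
    rwa [F.ideal_last, LieSubmodule.top_toSubmodule, finrank_top] at h
  have := B.finrank_add_finrank_orthogonal' (vergne F ξ)
  rw [horth, inf_eq_right.2 hle, hker, hm] at this
  omega

theorem finrank_vergne_eq {ξ η : Dual 𝕜 𝔤} {k : Fin m → ℕ} (hξ : ξ ∈ isotropyStratum F k)
    (hη : η ∈ isotropyStratum F k) : finrank 𝕜 (vergne F ξ) = finrank 𝕜 (vergne F η) := by
  have h1 := two_mul_finrank_vergne F ξ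
  have h2 := two_mul_finrank_vergne F η
  -- For `m = 0` the stratum imposes no condition, but the only ideal is zero.
  rcases Fin.eq_zero_or_eq_succ (Fin.last m) with h0 | ⟨i, hi⟩
  · have h (ζ : Dual 𝕜 𝔤) : isotropyIn (F.ideal 0) ζ = ⊥ := by
      rw [eq_bot_iff]
      intro x hx
      simpa [F.ideal_zero] using (mem_isotropyIn.1 hx).1
    rw [h0, h] at h1 h2
    omega
  · rw [hi, finrank_isotropyIn, hξ i] at h1
    rw [hi, finrank_isotropyIn, hη i] at h2
    omega

end Algebra

/-! ### Continuous sections of kernels of constant dimension -/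

section Kernel

open Filter Topology

variable {𝕜 E W X : Type*} [RCLike 𝕜] [AddCommGroup E] [Module 𝕜 E] [FiniteDimensional 𝕜 E]
  [AddCommGroup W] [Module 𝕜 W] [TopologicalSpace X]

/-- Every vector in the kernel of one member of a continuous family of linear maps extends to a
section, continuous at the given point, of the kernels of constant dimension. -/
theorem exists_continuousAt_section_ker (A : X → E →ₗ[𝕜] W) (a : X)
    (hA : ∀ (x : E) (l : Dual 𝕜 W), Continuous fun t => l (A t x)) {v : E} (hv : A a v = 0) :
    ∃ s : X → E, s a = v ∧ (∀ l : Dual 𝕜 E, ContinuousAt (fun t => l (s t)) a) ∧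
      ∀ᶠ t in 𝓝 a, finrank 𝕜 (LinearMap.ker (A t)) = finrank 𝕜 (LinearMap.ker (A a)) →
        A t (s t) = 0 := by
  obtain ⟨r, hr⟩ := (A a).rangeRestrict.exists_rightInverse_of_surjective (A a).range_rangeRestrict
  obtain ⟨G, hG⟩ := r.exists_extend
  -- `G` is a generalized inverse of `A a`.
  have hAG (x : E) : A a (G (A a x)) = A a x := by
    have h1 : G (A a x) = r ((A a).rangeRestrict x) := congr($hG ((A a).rangeRestrict x))
    have h2 := congr($hr ((A a).rangeRestrict x))
    rw [h1]
    exact congr(($h2 : W))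
  -- `T a = 1`, and on `ker (A t)` one has `T t x = x - G (A a x)`, which `A a` kills. So an
  -- invertible `T t` carries `ker (A t)` into `ker (A a)`, onto if the dimensions agree, and the
  -- section is `(T t)⁻¹ v`.
  let T (t : X) : E →ₗ[𝕜] E := LinearMap.id + G ∘ₗ (A t - A a)
  let b := finBasis 𝕜 E
  let M (t : X) := LinearMap.toMatrix b b (T t)
  have hMa : M a = 1 := by simp [M, T]
  have hM : Continuous M := by
    refine continuous_matrix fun i j => ?_
    have h (t : X) : M t i j = b.repr (b j) i + ((b.coord i ∘ₗ G) (A t (b j)) -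
        (b.coord i ∘ₗ G) (A a (b j))) := by
      simp [M, T, LinearMap.toMatrix_apply, Matrix.one_apply, Finsupp.single_apply, eq_comm]
    simp only [h]
    exact continuous_const.add ((hA (b j) (b.coord i ∘ₗ G)).sub continuous_const)
  have hinv : ContinuousAt (fun t => (M t)⁻¹) a := by
    refine ContinuousAt.comp (g := fun N => N⁻¹) (continuousAt_matrix_inv _ ?_) hM.continuousAt
    rw [hMa, Matrix.det_one, Ring.inverse_eq_inv']
    exact continuousAt_inv₀ one_ne_zero
  refine ⟨fun t => Matrix.toLin b b (M t)⁻¹ v, by simp [hMa], fun l => ?_, ?_⟩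
  · have h (t : X) : l (Matrix.toLin b b (M t)⁻¹ v)
        = ∑ i, (∑ j, (M t)⁻¹ i j * b.repr v j) * l (b i) := by
      simp [Matrix.toLin_apply, Matrix.mulVec, dotProduct]
    simp only [h]
    have hij (i j) : ContinuousAt (fun t => (M t)⁻¹ i j) a :=
      (continuous_apply_apply i j).continuousAt.comp hinv
    exact tendsto_finsetSum _ fun i _ => (tendsto_finsetSum _ fun j _ =>
      (hij i j).mul continuousAt_const).mul continuousAt_const
  · have hdet : ∀ᶠ t in 𝓝 a, (M t).det ≠ 0 :=
      (hM.matrix_det.continuousAt).eventually_ne (by simp [hMa])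
    filter_upwards [hdet] with t ht hrank
    have hMu : IsUnit (M t).det := ht.isUnit
    have hTM : Matrix.toLin b b (M t) = T t := Matrix.toLin_toMatrix b b (T t)
    have hright (x : E) : T t (Matrix.toLin b b (M t)⁻¹ x) = x := by
      rw [← hTM, ← LinearMap.comp_apply, ← Matrix.toLin_mul, Matrix.mul_nonsing_inv _ hMu,
        Matrix.toLin_one, LinearMap.id_apply]
    have hleft (x : E) : Matrix.toLin b b (M t)⁻¹ (T t x) = x := by
      rw [← hTM, ← LinearMap.comp_apply, ← Matrix.toLin_mul, Matrix.nonsing_inv_mul _ hMu,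
        Matrix.toLin_one, LinearMap.id_apply]
    have hmap : (LinearMap.ker (A t)).map (T t) = LinearMap.ker (A a) := by
      refine Submodule.eq_of_le_of_finrank_eq ?_ ?_
      · rintro _ ⟨x, hx, rfl⟩
        have hx : A t x = 0 := hx
        simp [T, hx, hAG]
      · rw [← hrank]
        exact (Submodule.equivMapOfInjective _
          (Function.LeftInverse.injective hleft) _).finrank_eq.symm
    obtain ⟨x, hx, hxv⟩ : v ∈ (LinearMap.ker (A t)).map (T t) := hmap ▸ hv
    rw [← hxv, hleft]
    exact hx

end Kernel

/-! ### Continuity criterion for maps into the Grassmannian -/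

section Topology

open Filter Topology

variable {𝕜 V X : Type*} [RCLike 𝕜] [AddCommGroup V] [Module 𝕜 V] [FiniteDimensional 𝕜 V]
  [TopologicalSpace X]

theorem continuousAt_moduleTopology {f : X → V} {a : X}
    (hf : ∀ l : Dual 𝕜 V, ContinuousAt (fun t => l (f t)) a) :
    @ContinuousAt _ _ _ (moduleTopology 𝕜 V) f a := by
  let : TopologicalSpace V := moduleTopology 𝕜 V
  have : IsModuleTopology 𝕜 V := ⟨rfl⟩
  have : ContinuousAdd V := IsModuleTopology.toContinuousAdd 𝕜 V
  let b := finBasis 𝕜 V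
  have h1 : ContinuousAt (fun t => b.equivFun (f t)) a :=
    continuousAt_pi.2 fun i => hf (b.coord i)
  have h2 : Continuous b.equivFun.symm :=
    IsModuleTopology.continuous_of_linearMap b.equivFun.symm.toLinearMap
  simpa [Function.comp_def] using h2.continuousAt.comp h1

theorem eventually_linearIndependent {ι : Type*} [Finite ι] {s : ι → X → V} {a : X}
    (hs : ∀ i, ∀ l : Dual 𝕜 V, ContinuousAt (fun t => l (s i t)) a)
    (ha : LinearIndependent 𝕜 fun i => s i a) :
    ∀ᶠ t in 𝓝 a, LinearIndependent 𝕜 fun i => s i t := by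
  let e := (finBasis 𝕜 V).equivFun
  have he (t : X) : (LinearIndependent 𝕜 fun i => e (s i t)) ↔
      LinearIndependent 𝕜 fun i => s i t :=
    e.toLinearMap.linearIndependent_iff e.ker
  have hc : ContinuousAt (fun t i => e (s i t)) a :=
    continuousAt_pi.2 fun i => continuousAt_pi.2 fun j => hs i ((finBasis 𝕜 V).coord j)
  have ho : IsOpen {f : ι → Fin (finrank 𝕜 V) → 𝕜 | LinearIndependent 𝕜 f} :=
    isOpen_setOfPred_linearIndependent
  filter_upwards [hc.eventually_mem (ho.mem_nhds ((he a).2 ha))] with t ht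
  exact (he t).1 ht

/-- A map to the Grassmannian is continuous at a point near which its values are spanned by a
tuple of vectors that is linearly independent and varies continuously at the point. -/
theorem continuousAt_grassmannian {d : ℕ} {p : X → Submodule 𝕜 V} {s : Fin d → X → V} {a : X}
    (hs : ∀ i, ∀ l : Dual 𝕜 V, ContinuousAt (fun t => l (s i t)) a)
    (ha : LinearIndependent 𝕜 fun i => s i a)
    (hp : ∀ᶠ t in 𝓝 a, p t = Submodule.span 𝕜 (Set.range fun i => s i t)) :
    ContinuousAt p a := by
  classical
  let : TopologicalSpace V := moduleTopology 𝕜 V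
  have hli := eventually_linearIndependent hs ha
  -- The fallback frame is used only away from a neighbourhood of `a`.
  let f (t : X) : Frame 𝕜 V d :=
    if h : LinearIndependent 𝕜 fun i => s i t then ⟨_, h⟩ else ⟨_, ha⟩
  have hfs : ∀ᶠ t in 𝓝 a, (fun i => s i t) = (f t).1 := by
    filter_upwards [hli] with t ht
    simp [f, ht]
  have hf : ContinuousAt f a := by
    refine Topology.IsInducing.subtypeVal.continuousAt_iff.2 ?_
    have h : ContinuousAt (fun t i => s i t) a :=
      continuousAt_pi.2 fun i => continuousAt_moduleTopology (hs i)
    exact h.congr hfs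
  have hq : Continuous fun v : (Σ k : ℕ, Frame 𝕜 V k) =>
      Submodule.span 𝕜 (Set.range v.2.1) := continuous_coinduced_rng
  have hq' : Continuous fun v : Frame 𝕜 V d => Submodule.span 𝕜 (Set.range v.1) :=
    hq.comp continuous_sigmaMk
  refine (hq'.continuousAt.comp hf).congr ?_
  filter_upwards [hp, hfs] with t ht hft
  rw [ht, hft, Function.comp_apply]

end Topology

/-! ### Continuity of the Vergne mapping -/

section Vergne

open Filter Topology

variable {𝕜 𝔤 : Type*} [RCLike 𝕜] [LieRing 𝔤] [LieAlgebra 𝕜 𝔤] [FiniteDimensional 𝕜 𝔤]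

theorem exists_continuousAt_section_isotropyIn (I : LieIdeal 𝕜 𝔤) {ξ : Dual 𝕜 𝔤} {v : 𝔤}
    (hv : v ∈ isotropyIn I ξ) :
    ∃ s : Dual 𝕜 𝔤 → 𝔤, s ξ = v ∧ (∀ l : Dual 𝕜 𝔤, ContinuousAt (fun η => l (s η)) ξ) ∧
      ∀ᶠ η in 𝓝 ξ, finrank 𝕜 (idealIsotropy I η) = finrank 𝕜 (idealIsotropy I ξ) →
        s η ∈ isotropyIn I η := by
  let A (η : Dual 𝕜 𝔤) : I →ₗ[𝕜] Dual 𝕜 I :=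
    LinearMap.mk₂ 𝕜 (fun a b : I => η ⁅(a : 𝔤), (b : 𝔤)⁆) (by simp) (by simp) (by simp) (by simp)
  have hker (η : Dual 𝕜 𝔤) : LinearMap.ker (A η) = idealIsotropy I η := by
    ext x
    exact ⟨fun h y => congr($h y), fun h => LinearMap.ext h⟩
  have : IsModuleTopology 𝕜 (Dual 𝕜 𝔤) := ⟨rfl⟩
  -- For fixed `x` and `l` this is linear in `η`.
  have hA (x : I) (l : Dual 𝕜 (Dual 𝕜 I)) : Continuous fun η => l (A η x) :=
    IsModuleTopology.continuous_of_linearMap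
      (l ∘ₗ ((LieAlgebra.ad 𝕜 𝔤 x : 𝔤 →ₗ[𝕜] 𝔤) ∘ₗ I.toSubmodule.subtype).dualMap)
  obtain ⟨w, hw, rfl⟩ := hv
  rw [← hker] at hw
  obtain ⟨s, hs, hsc, hsk⟩ := exists_continuousAt_section_ker A ξ hA hw
  refine ⟨fun η => s η, congrArg _ hs, fun l => hsc (l ∘ₗ I.toSubmodule.subtype), ?_⟩
  filter_upwards [hsk] with η hη hrank
  exact ⟨s η, hker η ▸ hη (by rwa [hker, hker]), rfl⟩

variable {m : ℕ} (F : JordanHolderSequence 𝕜 𝔤 m)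

theorem finrank_idealIsotropy_mem_multiIndices (ξ : Dual 𝕜 𝔤) :
    (fun j : Fin m => finrank 𝕜 (idealIsotropy (F.ideal j.succ) ξ)) ∈ multiIndices m := fun j => by
  have h := (idealIsotropy (F.ideal j.succ) ξ).finrank_le
  rwa [F.finrank_ideal, Fin.val_succ] at h

theorem finite_multiIndices (m : ℕ) : (multiIndices m).Finite :=
  (Set.finite_Iic fun j : Fin m => (j : ℕ) + 1).subset fun _ hk => hk

/-- If the strata of `Ξ` are relatively closed, they are also relatively open. -/
theorem eventually_mem_isotropyStratum {Ξ : Set (Dual 𝕜 𝔤)}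
    (hΞ : ∀ k ∈ multiIndices m, IsClosed {ξ : Ξ | (ξ : Dual 𝕜 𝔤) ∈ isotropyStratum F k}) (ξ : Ξ) :
    ∀ᶠ η : Ξ in 𝓝 ξ, (η : Dual 𝕜 𝔤) ∈
      isotropyStratum F fun j => finrank 𝕜 (idealIsotropy (F.ideal j.succ) (ξ : Dual 𝕜 𝔤)) := by
  set k : Fin m → ℕ := fun j => finrank 𝕜 (idealIsotropy (F.ideal j.succ) (ξ : Dual 𝕜 𝔤)) with hk
  -- The other strata form a finite union of closed sets avoiding `ξ`.
  have hcl : IsClosed (⋃ k' ∈ multiIndices m \ {k},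
      {η : Ξ | (η : Dual 𝕜 𝔤) ∈ isotropyStratum F k'}) :=
    ((finite_multiIndices m).subset Set.sdiff_subset).isClosed_biUnion fun k' hk' => hΞ k' hk'.1
  have hξ : ξ ∉ ⋃ k' ∈ multiIndices m \ {k},
      {η : Ξ | (η : Dual 𝕜 𝔤) ∈ isotropyStratum F k'} := by
    simp only [Set.mem_iUnion, not_exists]
    intro k' hk' h
    exact hk'.2 (funext fun j => (h j).symm)
  filter_upwards [hcl.isOpen_compl.mem_nhds hξ] with η hη j
  by_contra hne
  exact hη (Set.mem_biUnion ⟨finrank_idealIsotropy_mem_multiIndices F (η : Dual 𝕜 𝔤),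
    fun h => hne (congrFun h j)⟩ fun _ => rfl)

theorem continuous_vergne {Ξ : Set (Dual 𝕜 𝔤)}
    (hΞ : ∀ k ∈ multiIndices m, IsClosed {ξ : Ξ | (ξ : Dual 𝕜 𝔤) ∈ isotropyStratum F k}) :
    Continuous fun ξ : Ξ => vergne F (ξ : Dual 𝕜 𝔤) := by
  refine continuous_iff_continuousAt.2 fun ξ => ?_
  -- Extracting the basis from the union, not the sum, puts each vector in a single isotropy
  -- subspace.
  obtain ⟨B, hB, hspan, hli⟩ := exists_linearIndependent 𝕜
    (⋃ j : Fin m, (isotropyIn (F.ideal j.succ) (ξ : Dual 𝕜 𝔤) : Set 𝔤))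
  rw [Submodule.span_iUnion] at hspan
  simp only [Submodule.span_eq] at hspan
  rw [← vergne_eq_iSup_isotropyIn] at hspan
  have : Finite B := hli.finite
  let e := Finite.equivFin B
  have hmem (i : Fin (Nat.card B)) :
      ∃ j : Fin m, (e.symm i : 𝔤) ∈ isotropyIn (F.ideal j.succ) (ξ : Dual 𝕜 𝔤) :=
    Set.mem_iUnion.1 (hB (e.symm i).2)
  choose j hj using hmem
  choose s hs hsc hsi using fun i => exists_continuousAt_section_isotropyIn _ (hj i)
  have hsc' (i) (l : Dual 𝕜 𝔤) : ContinuousAt (fun η : Ξ => l (s i η)) ξ :=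
    (hsc i l).comp continuousAt_subtype_val
  have hli' : LinearIndependent 𝕜 fun i => s i ξ := by
    simp only [hs]
    exact hli.comp _ e.symm.injective
  have hrange : Submodule.span 𝕜 (Set.range fun i => s i ξ) = vergne F (ξ : Dual 𝕜 𝔤) := by
    rw [← hspan]
    simp only [hs]
    congr 1
    exact (e.symm.surjective.range_comp ((↑) : B → 𝔤)).trans Subtype.range_coe
  refine continuousAt_grassmannian (s := fun i (η : Ξ) => s i η) hsc' hli' ?_
  have hsi' : ∀ᶠ η : Ξ in 𝓝 ξ, ∀ i,
      finrank 𝕜 (idealIsotropy (F.ideal (j i).succ) (η : Dual 𝕜 𝔤)) =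
        finrank 𝕜 (idealIsotropy (F.ideal (j i).succ) (ξ : Dual 𝕜 𝔤)) →
      s i η ∈ isotropyIn (F.ideal (j i).succ) (η : Dual 𝕜 𝔤) :=
    eventually_all.2 fun i => continuousAt_subtype_val.eventually (hsi i)
  filter_upwards [eventually_mem_isotropyStratum F hΞ ξ, hsi',
    eventually_linearIndependent hsc' hli'] with η hη hi hηli
  refine (Submodule.eq_of_le_of_finrank_eq (Submodule.span_le.2 ?_) ?_).symm
  · rintro _ ⟨i, rfl⟩
    exact isotropyIn_le_vergne F η (j i) (hi i (hη (j i)))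
  · rw [finrank_vergne_eq F hη (η := ξ) fun _ => rfl, ← hrange, finrank_span_eq_card hηli,
      finrank_span_eq_card hli']

end Vergne

theorem theorem6p6 {𝕜 𝔤 : Type*} [RCLike 𝕜] [LieRing 𝔤] [LieAlgebra 𝕜 𝔤]
    [FiniteDimensional 𝕜 𝔤] {m : ℕ} (F : JordanHolderSequence 𝕜 𝔤 m) :
    ∃ p : Dual 𝕜 𝔤 → LieSubalgebra 𝕜 𝔤,
      (∀ ξ, (p ξ).toSubmodule = vergne F ξ) ∧
      ∀ Ξ : Set (Dual 𝕜 𝔤),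
        (∀ k ∈ multiIndices m, IsClosed {ξ : Ξ | (ξ : Dual 𝕜 𝔤) ∈ isotropyStratum F k}) →
        Continuous (fun ξ : Ξ => p ξ) :=
  ⟨fun ξ => { vergne F ξ with lie_mem' := lie_mem_vergne F ξ }, fun _ => rfl, fun _ hΞ =>
    continuous_induced_rng.2 (continuous_vergne F hΞ)⟩
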